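/- A (left) nearring with identity is a set $R$ with operations $+,\cdot$ such that $(R,+)$ is a (not necessarily abelian) group, $(R,\cdot)$ is a monoid, and $x(y+z)=xy+xz$ for all $x,y,z\in R$. It is called local if the set $L$ of its non-invertible elements is a subgroup of $(R,+)$; $R^*$ denotes the group of invertible elements. For a prime $p$ and integers $1\le d\le n\le m$ let $$G(p^m,p^n,p^d)=\langle a,b,c\mid a^{p^m}=b^{p^n}=c^{p^d}=1,\ b^{-1}ab=ac,\ a^{-1}ca=b^{-1}cb=c\rangle .$$ Theorem. Let $p$ be an odd prime, let $1\le d\le n\le m$, and let $R$ be a local nearring whose additive group is isomorphic to $G(p^m,p^n,p^d)$. Call a pair $(b,c)$ of elements of $R$ admissible if, with $a$ denoting the multiplicative identity of $R$, one has (written additively) $ap^m=bp^n=cp^d=0$, $-b+a+b=a+c$, $-a+c+a=-b+c+b=c$, and every $x\in R$ is uniquely of the form $x=ax_1+bx_2+cx_3$ with $0\le x_1<p^m$, $0\le x_2<p^n$, $0\le x_3<p^d$. Then: (0) $L$ has index $p$ in $(R,+)$, and $|R^*|=p^{m+n+d-1}(p-1)$. There is an admissible pair $(b,c)$ with $b$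 non-invertible; if $n<m$, then $b$ is non-invertible for every admissible pair $(b,c)$. For every admissible pair $(b,c)$ with $b$ non-invertible (hence for every admissible pair if $n<m$): (1) $L=\langle ap\rangle+\langle b\rangle+\langle c\rangle$; (2) for all integers $x_1,x_2,x_3$, the element $x=ax_1+bx_2+cx_3$ is invertible if and only if $x_1\not\equiv 0\pmod p$. -/

import Mathlib

open scoped Pointwise

/-- A (left) nearring with identity: a not necessarily commutative additive group with an
associative multiplication that has an identity element and satisfies the left distributive law. -/
class LeftNearring (R : Type*) extends AddGroup R, Monoid R where
  protected left_distrib : ∀ x y z : R, x * (y + z) = x * y + x * z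

/-- A nearring with identity is local if the set of all its non-invertible elements is a subgroup
of its additive group. -/
class LocalNearring (R : Type*) extends LeftNearring R where
  nonunits_eq_addSubgroup : ∃ H : AddSubgroup R, (H : Set R) = nonunits R

/-- The subgroup `L` of all non-invertible elements of a local nearring. -/
def nonunitsAddSubgroup (R : Type*) [LocalNearring R] : AddSubgroup R where
  carrier := nonunits R
  zero_mem' := by
    obtain ⟨H, hH⟩ := LocalNearring.nonunits_eq_addSubgroup (R := R)
    rw [← hH]
    exact H.zero_mem
  add_mem' := by
    obtain ⟨H, hH⟩ := LocalNearring.nonunits_eq_addSubgroup (R := R)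
    rw [← hH]
    exact fun hx hy => H.add_mem hx hy
  neg_mem' := by
    obtain ⟨H, hH⟩ := LocalNearring.nonunits_eq_addSubgroup (R := R)
    rw [← hH]
    exact fun hx => H.neg_mem hx

namespace GroupG

/-- The free generator `a`. -/
def genA : FreeGroup (Fin 3) := FreeGroup.of 0

/-- The free generator `b`. -/
def genB : FreeGroup (Fin 3) := FreeGroup.of 1

/-- The free generator `c`. -/
def genC : FreeGroup (Fin 3) := FreeGroup.of 2

/-- The relators of `a ^ p ^ m = b ^ p ^ n = c ^ p ^ d = 1`, `b⁻¹ a b = a c`,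
`a⁻¹ c a = c`, `b⁻¹ c b = c`. -/
def relators (p m n d : ℕ) : Set (FreeGroup (Fin 3)) :=
  {genA ^ p ^ m, genB ^ p ^ n, genC ^ p ^ d,
    genB⁻¹ * genA * genB * (genA * genC)⁻¹,
    genA⁻¹ * genC * genA * genC⁻¹,
    genB⁻¹ * genC * genB * genC⁻¹}

end GroupG

/-- The group `G(p^m, p^n, p^d)`, given by generators and relations. -/
abbrev GroupG (p m n d : ℕ) : Type := PresentedGroup (GroupG.relators p m n d)

/-- `a`, `b`, `c` are standard generators of an additively written group `G(p^m, p^n, p^d)`: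
they satisfy the defining relations, and every element is uniquely of the form
`a x₁ + b x₂ + c x₃` with `0 ≤ x₁ < p^m`, `0 ≤ x₂ < p^n`, `0 ≤ x₃ < p^d`. -/
structure IsStandardGenerators {A : Type*} [AddGroup A] (p m n d : ℕ) (a b c : A) : Prop where
  nsmul_a : (p ^ m) • a = 0
  nsmul_b : (p ^ n) • b = 0
  nsmul_c : (p ^ d) • c = 0
  conj_a_b : -b + a + b = a + c
  conj_c_a : -a + c + a = c
  conj_c_b : -b + c + b = c
  existsUnique_coeffs : ∀ x : A, ∃! t : Fin (p ^ m) × Fin (p ^ n) × Fin (p ^ d),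
    x = (t.1 : ℕ) • a + (t.2.1 : ℕ) • b + (t.2.2 : ℕ) • c

-- Let Φ be the common kernel of the mod p coordinates `α` and `β`; it is the Frattini subgroup of
-- `(R, +)` and has index p². Left multiplications are additive endomorphisms, hence preserve Φ, so
-- Φ contains no unit (`ker_le_nonunits`) and L, which misses 1, has index p or p².
--
-- The crux is L ≠ Φ (`exists_nonunit_notMem_ker`). If L = Φ, every element outside Φ is a unit, and
-- by cancellation only multiplication by 1 can fix such an element. Since -1 ≠ 1, this forces -1 to
-- invert `R` modulo Φ, and then modulo ⟨c⟩ (`add_neg_one_mul_mem`), so that -1 fixes the commutator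
-- c. The same holds for every conjugate t of -1 by a unit. Hence t * -1 moves elements only by
-- multiples of c and fixes something outside Φ, which gives t = -1. Conjugating by the unit 1 + c
-- now yields 2c = 0, which is absurd for odd p.
--
-- So L has index p, and the units are counted as a complement. A non-unit b' outside Φ with p^n b'
-- = 0 is independent of 1 modulo Φ, and such a pair extends to standard generators
-- (`exists_of_det_ne_zero`). For any admissible pair, c and p • 1 lie in Φ ⊆ L; with b in L,
-- membership in L depends only on the first coordinate.

universe u

/-! ### Groups generated by a, b and their central commutator c -/

section CentralExtension

variable {G : Type u} [AddGroup G]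

theorem addCommute_of_closure_eq_top {s : Set G} {c : G} (hs : AddSubgroup.closure s = ⊤)
    (h : ∀ x ∈ s, AddCommute c x) (x : G) : AddCommute c x := by
  have hx : x ∈ AddSubgroup.closure s := hs ▸ AddSubgroup.mem_top x
  induction hx using AddSubgroup.closure_induction with
  | mem x hx => exact h x hx
  | zero => exact AddCommute.zero_right c
  | add x y _ _ hx hy => exact hx.add_right hy
  | neg x _ hx => exact hx.neg_right

theorem normal_zmultiples_of_central {c : G} (hc : ∀ x, AddCommute c x) :
    (AddSubgroup.zmultiples c).Normal := by
  refine ⟨fun n hn g => ?_⟩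
  obtain ⟨k, rfl⟩ := AddSubgroup.mem_zmultiples_iff.1 hn
  have h : g + k • c = k • c + g := ((hc g).zsmul_left k).eq.symm
  rw [h, add_neg_cancel_right]
  exact AddSubgroup.zsmul_mem_zmultiples c k

/-- If `a`, `b`, `c` generate `G`, `c` is central and is the commutator of `a` and `b`, then the
quotient by `⟨c⟩` is commutative. -/
theorem exists_hom_ker_eq_zmultiples {a b c : G} (hab : a + b = b + a + c)
    (hc : ∀ x, AddCommute c x) (hgen : AddSubgroup.closure {a, b, c} = ⊤) :
    ∃ (Q : Type u) (_ : AddCommGroup Q) (q : G →+ Q),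
      ∀ x, q x = 0 ↔ x ∈ AddSubgroup.zmultiples c := by
  have := normal_zmultiples_of_central hc
  let q := QuotientAddGroup.mk' (AddSubgroup.zmultiples c)
  have hker : ∀ x, q x = 0 ↔ x ∈ AddSubgroup.zmultiples c := fun x =>
    QuotientAddGroup.eq_zero_iff x
  have hqc : q c = 0 := (hker c).2 (AddSubgroup.mem_zmultiples c)
  have hqab : AddCommute (q a) (q b) := by
    have := congrArg q hab
    rw [map_add, map_add, map_add, hqc, add_zero] at this
    exact this
  have hcomm : ∀ y ∈ ({a, b, c} : Set G), ∀ x, AddCommute (q y) (q x) := by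
    intro y hy x
    have hx : x ∈ AddSubgroup.closure {a, b, c} := hgen ▸ AddSubgroup.mem_top x
    induction hx using AddSubgroup.closure_induction with
    | mem x hx =>
      rcases hx with rfl | rfl | rfl <;> rcases hy with rfl | rfl | rfl <;>
        simp [hqc, hqab, hqab.symm]
    | zero => simp
    | add x y _ _ hx hy => rw [map_add]; exact hx.add_right hy
    | neg x _ hx => rw [map_neg]; exact hx.neg_right
  have hall : ∀ x y, AddCommute (q x) (q y) := by
    intro x y
    have hx : x ∈ AddSubgroup.closure {a, b, c} := hgen ▸ AddSubgroup.mem_top x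
    induction hx using AddSubgroup.closure_induction with
    | mem x hx => exact hcomm x hx y
    | zero => simp
    | add x z _ _ hx hz => rw [map_add]; exact hx.add_left hz
    | neg x _ hx => rw [map_neg]; exact hx.neg_left
  refine ⟨G ⧸ AddSubgroup.zmultiples c, { add_comm := ?_ }, q, hker⟩
  intro x y
  obtain ⟨x, rfl⟩ := QuotientAddGroup.mk'_surjective _ x
  obtain ⟨y, rfl⟩ := QuotientAddGroup.mk'_surjective _ y
  exact (hall x y).eq

theorem exists_zsmul_of_closure_eq_top {a b c : G} (hab : a + b = b + a + c)
    (hc : ∀ x, AddCommute c x) (hgen : AddSubgroup.closure {a, b, c} = ⊤) (x : G) :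
    ∃ i j k : ℤ, x = i • a + j • b + k • c := by
  obtain ⟨Q, _, q, hq⟩ := exists_hom_ker_eq_zmultiples hab hc hgen
  have hqc : q c = 0 := (hq c).2 (AddSubgroup.mem_zmultiples c)
  suffices h : ∃ i j : ℤ, q x = i • q a + j • q b by
    obtain ⟨i, j, h⟩ := h
    obtain ⟨k, hk⟩ := AddSubgroup.mem_zmultiples_iff.1
      ((hq (-(i • a + j • b) + x)).1 (by simp [h]))
    exact ⟨i, j, k, by rw [hk, add_neg_cancel_left]⟩
  have hx : x ∈ AddSubgroup.closure {a, b, c} := hgen ▸ AddSubgroup.mem_top x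
  induction hx using AddSubgroup.closure_induction with
  | mem x hx =>
    rcases hx with rfl | rfl | rfl
    · exact ⟨1, 0, by simp⟩
    · exact ⟨0, 1, by simp⟩
    · exact ⟨0, 0, by simp [hqc]⟩
  | zero => exact ⟨0, 0, by simp⟩
  | add x y _ _ hx hy =>
    obtain ⟨i, j, hx⟩ := hx
    obtain ⟨i', j', hy⟩ := hy
    exact ⟨i + i', j + j', by rw [map_add, hx, hy, add_zsmul, add_zsmul]; abel⟩
  | neg x _ hx =>
    obtain ⟨i, j, hx⟩ := hx
    exact ⟨-i, -j, by rw [map_neg, hx, neg_zsmul, neg_zsmul]; abel⟩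

/-- Collection in class two: moving x past N copies of y costs N copies of z, and these costs add up
to the binomial coefficient. -/
theorem nsmul_add_of_commutator {x y z : G} (h : x + y = y + x + z) (hx : AddCommute z x)
    (hy : AddCommute z y) (N : ℕ) : N • (x + y) + N.choose 2 • z = N • x + N • y := by
  have key : ∀ N : ℕ, x + N • y = N • y + x + N • z := by
    intro N
    induction N with
    | zero => simp
    | succ N ih =>
      have h1 : N • z + y = y + N • z := (hy.nsmul_left N).eq
      calc x + (N + 1) • y = (x + N • y) + y := by rw [succ_nsmul, add_assoc]
        _ = N • y + x + (N • z + y) := by rw [ih]; simp only [add_assoc]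
        _ = N • y + (x + y) + N • z := by rw [h1]; simp only [add_assoc]
        _ = _ := by rw [h, succ_nsmul, succ_nsmul']; simp only [add_assoc]
  induction N with
  | zero => simp
  | succ N ih =>
    have hz : (x + y) + N.choose 2 • z = N.choose 2 • z + (x + y) :=
      ((hx.add_right hy).nsmul_left _).eq.symm
    have hz' : y + N • z = N • z + y := (hy.nsmul_left N).eq.symm
    have e : (N + 1).choose 2 = N.choose 2 + N := by
      rw [Nat.choose_succ_succ' N 1, Nat.choose_one_right, add_comm]
    calc (N + 1) • (x + y) + (N + 1).choose 2 • z
        = N • (x + y) + ((x + y) + N.choose 2 • z) + N • z := by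
          rw [e, succ_nsmul, add_nsmul]; simp only [add_assoc]
      _ = (N • (x + y) + N.choose 2 • z) + x + (y + N • z) := by rw [hz]; simp only [add_assoc]
      _ = N • x + (N • y + x + N • z) + y := by rw [ih, hz']; simp only [add_assoc]
      _ = (N + 1) • x + (N + 1) • y := by
        rw [← key, succ_nsmul, succ_nsmul]; simp only [add_assoc]

/-- For odd N the coefficient `N.choose 2` is a multiple of N, so the commutator term disappears. -/
theorem nsmul_add_eq_zero_of_odd {x y z : G} {N : ℕ} (hN : Odd N) (h : x + y = y + x + z)
    (hx : AddCommute z x) (hy : AddCommute z y) (hNx : N • x = 0) (hNy : N • y = 0)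
    (hNz : N • z = 0) : N • (x + y) = 0 := by
  have h1 := nsmul_add_of_commutator h hx hy N
  obtain ⟨k, hk⟩ := hN
  have h2 : N.choose 2 = k * N := by
    rw [Nat.choose_two_right, hk, Nat.add_sub_cancel,
      show (2 * k + 1) * (2 * k) = k * (2 * k + 1) * 2 by ring, Nat.mul_div_cancel _ two_pos]
  rwa [h2, mul_nsmul', hNz, nsmul_zero, add_zero, hNx, hNy, add_zero] at h1

theorem exists_fin_nsmul_eq_zsmul {x : G} {N : ℕ} (hN : 0 < N) (hx : N • x = 0) (i : ℤ) :
    ∃ t : Fin N, i • x = (t : ℕ) • x := by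
  have hN' : (N : ℤ) ≠ 0 := by exact_mod_cast hN.ne'
  have h0 : 0 ≤ i % N := Int.emod_nonneg _ hN'
  refine ⟨⟨(i % N).toNat, ?_⟩, ?_⟩
  · have := Int.emod_lt_of_pos i (show (0 : ℤ) < N by exact_mod_cast hN)
    omega
  · have h1 : ((i % N).toNat : ℤ) = i % N := Int.toNat_of_nonneg h0
    calc i • x = (i % N + N * (i / N)) • x := by rw [Int.emod_add_mul_ediv]
      _ = (i % N) • x := by
        rw [add_zsmul, mul_zsmul', natCast_zsmul, hx, zsmul_zero, add_zero]
      _ = _ := by rw [← natCast_zsmul, h1]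

end CentralExtension

/-! ### Standard generators and how to change them -/

section StandardGenerators

variable {G : Type u} [AddGroup G] {p m n d : ℕ} {a b c : G}

theorem surjective_coeffs (hp : p.Prime) (ha : (p ^ m) • a = 0) (hb : (p ^ n) • b = 0)
    (hcd : (p ^ d) • c = 0) (hab : a + b = b + a + c) (hc : ∀ x, AddCommute c x)
    (hgen : AddSubgroup.closure {a, b, c} = ⊤) :
    Function.Surjective fun t : Fin (p ^ m) × Fin (p ^ n) × Fin (p ^ d) =>
      (t.1 : ℕ) • a + (t.2.1 : ℕ) • b + (t.2.2 : ℕ) • c := by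
  intro x
  obtain ⟨i, j, k, rfl⟩ := exists_zsmul_of_closure_eq_top hab hc hgen x
  obtain ⟨r, hr⟩ := exists_fin_nsmul_eq_zsmul (Nat.pow_pos hp.pos) ha i
  obtain ⟨s, hs⟩ := exists_fin_nsmul_eq_zsmul (Nat.pow_pos hp.pos) hb j
  obtain ⟨t, ht⟩ := exists_fin_nsmul_eq_zsmul (Nat.pow_pos hp.pos) hcd k
  exact ⟨(r, s, t), by rw [hr, hs, ht]⟩

/-- Generation makes the normal forms exhaust the group; the lower bound on its order then forces
them to be unique. -/
theorem isStandardGenerators_of_card (hp : p.Prime) (ha : (p ^ m) • a = 0)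
    (hb : (p ^ n) • b = 0) (hcd : (p ^ d) • c = 0) (hab : a + b = b + a + c)
    (hc : ∀ x, AddCommute c x) (hgen : AddSubgroup.closure {a, b, c} = ⊤)
    (hcard : p ^ (m + n + d) ≤ Nat.card G) : IsStandardGenerators p m n d a b c where
  nsmul_a := ha
  nsmul_b := hb
  nsmul_c := hcd
  conj_a_b := by rw [add_assoc, hab, add_assoc b, neg_add_cancel_left]
  conj_c_a := by rw [add_assoc, (hc a).eq, neg_add_cancel_left]
  conj_c_b := by rw [add_assoc, (hc b).eq, neg_add_cancel_left]
  existsUnique_coeffs := by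
    have hsurj := surjective_coeffs hp ha hb hcd hab hc hgen
    have hbij := (Function.Surjective.bijective_of_nat_card_le hsurj (by
      simpa [pow_add, mul_assoc] using hcard))
    intro x
    obtain ⟨t, ht, hu⟩ := hbij.existsUnique x
    exact ⟨t, ht.symm, fun s hs => hu s hs.symm⟩

namespace IsStandardGenerators

theorem add_comm_a_b (h : IsStandardGenerators p m n d a b c) : a + b = b + a + c := by
  have := congrArg (b + ·) h.conj_a_b
  simpa [add_assoc] using this

theorem closure_eq_top (h : IsStandardGenerators p m n d a b c) :
    AddSubgroup.closure {a, b, c} = ⊤ := by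
  rw [eq_top_iff]
  rintro x -
  obtain ⟨t, ht, -⟩ := h.existsUnique_coeffs x
  rw [ht]
  have hs : ∀ y ∈ ({a, b, c} : Set G), y ∈ AddSubgroup.closure {a, b, c} :=
    fun y hy => AddSubgroup.subset_closure hy
  exact add_mem (add_mem (nsmul_mem (hs a (by simp)) _) (nsmul_mem (hs b (by simp)) _))
    (nsmul_mem (hs c (by simp)) _)

theorem central (h : IsStandardGenerators p m n d a b c) (x : G) : AddCommute c x := by
  refine addCommute_of_closure_eq_top h.closure_eq_top ?_ x
  rintro y (rfl | rfl | rfl)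
  · have := congrArg (y + ·) h.conj_c_a
    exact (by simpa [add_assoc] using this : c + y = y + c)
  · have := congrArg (y + ·) h.conj_c_b
    exact (by simpa [add_assoc] using this : c + y = y + c)
  · exact AddCommute.refl _

theorem exists_zsmul (h : IsStandardGenerators p m n d a b c) (x : G) :
    ∃ i j k : ℤ, x = i • a + j • b + k • c :=
  exists_zsmul_of_closure_eq_top h.add_comm_a_b h.central h.closure_eq_top x

theorem exists_hom (h : IsStandardGenerators p m n d a b c) :
    ∃ (Q : Type u) (_ : AddCommGroup Q) (q : G →+ Q),
      ∀ x, q x = 0 ↔ x ∈ AddSubgroup.zmultiples c :=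
  exists_hom_ker_eq_zmultiples h.add_comm_a_b h.central h.closure_eq_top

theorem exists_commutator (h : IsStandardGenerators p m n d a b c) (x y : G) :
    ∃ k : ℤ, x + y = y + x + k • c := by
  obtain ⟨Q, _, q, hq⟩ := h.exists_hom
  obtain ⟨k, hk⟩ := AddSubgroup.mem_zmultiples_iff.1
    ((hq (-(y + x) + (x + y))).1 (by simp only [map_add, map_neg]; abel))
  exact ⟨k, by rw [hk, add_neg_cancel_left]⟩

theorem bijective (h : IsStandardGenerators p m n d a b c) :
    Function.Bijective fun t : Fin (p ^ m) × Fin (p ^ n) × Fin (p ^ d) =>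
      (t.1 : ℕ) • a + (t.2.1 : ℕ) • b + (t.2.2 : ℕ) • c := by
  rw [Function.bijective_iff_existsUnique]
  intro x
  obtain ⟨t, ht, hu⟩ := h.existsUnique_coeffs x
  exact ⟨t, ht.symm, fun s hs => hu s hs.symm⟩

theorem card (h : IsStandardGenerators p m n d a b c) : Nat.card G = p ^ (m + n + d) := by
  rw [← Nat.card_eq_of_bijective _ h.bijective]
  simp [pow_add, mul_assoc]

theorem nsmul_a_ne_zero (h : IsStandardGenerators p m n d a b c) {k : ℕ} (hk : 0 < k)
    (hkm : k < p ^ m) (hn : 0 < p ^ n) (hd : 0 < p ^ d) : k • a ≠ 0 := by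
  intro h0
  have := @h.bijective.1 (⟨k, hkm⟩, ⟨0, hn⟩, ⟨0, hd⟩)
    (⟨0, hk.trans hkm⟩, ⟨0, hn⟩, ⟨0, hd⟩) (by simp [h0])
  simp at this
  omega

theorem c_ne_zero (h : IsStandardGenerators p m n d a b c) (hm : 0 < p ^ m) (hn : 0 < p ^ n)
    (hd : 1 < p ^ d) : c ≠ 0 := by
  intro h0
  have := @h.bijective.1 (⟨0, hm⟩, ⟨0, hn⟩, ⟨1, hd⟩)
    (⟨0, hm⟩, ⟨0, hn⟩, ⟨0, zero_lt_one.trans hd⟩) (by simp [h0])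
  simp at this

/-- For odd `p` the exponent of `G(p^m, p^n, p^d)` divides `p ^ m`. -/
theorem nsmul_eq_zero (h : IsStandardGenerators p m n d a b c) (hp : Odd p) (hdn : d ≤ n)
    (hnm : n ≤ m) (x : G) : (p ^ m) • x = 0 := by
  have hlift : ∀ {r : ℕ} {y : G}, r ≤ m → (p ^ r) • y = 0 → (p ^ m) • y = 0 := by
    intro r y hr hy
    obtain ⟨s, hs⟩ := pow_dvd_pow p hr
    rw [hs, mul_nsmul, hy, nsmul_zero]
  have hzs : ∀ {y : G} (i : ℤ), (p ^ m) • y = 0 → (p ^ m) • (i • y) = 0 := by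
    intro y i hy
    rw [← natCast_zsmul, ← mul_zsmul', mul_comm, mul_zsmul', natCast_zsmul, hy, zsmul_zero]
  have hc := hlift (hdn.trans hnm) h.nsmul_c
  have hadd : ∀ y z : G, (p ^ m) • y = 0 → (p ^ m) • z = 0 → (p ^ m) • (y + z) = 0 := by
    intro y z hy hz
    obtain ⟨k, hk⟩ := h.exists_commutator y z
    exact nsmul_add_eq_zero_of_odd hp.pow hk ((h.central y).zsmul_left k)
      ((h.central z).zsmul_left k) hy hz (hzs k hc)
  obtain ⟨i, j, k, rfl⟩ := h.exists_zsmul x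
  exact hadd _ _ (hadd _ _ (hzs i h.nsmul_a) (hzs j (hlift hnm h.nsmul_b))) (hzs k hc)

theorem map_c_eq_zero (h : IsStandardGenerators p m n d a b c) {Q : Type*} [AddCommGroup Q]
    (f : G →+ Q) : f c = 0 := by
  have := congrArg f h.add_comm_a_b
  rw [map_add, map_add, map_add, add_comm (f b)] at this
  exact left_eq_add.1 this

section Reduction

variable {α β : G →+ ZMod p}

theorem map_eq_zero (h : IsStandardGenerators p m n d a b c) (hαa : α a = 1)
    (hαb : α b = 0) (hβa : β a = 0) (hβb : β b = 1) {x : G} (hα : α x = 0) (hβ : β x = 0)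
    (f : G →+ ZMod p) : f x = 0 := by
  obtain ⟨i, j, k, rfl⟩ := h.exists_zsmul x
  simp only [map_add, map_zsmul, h.map_c_eq_zero, hαa, hαb, hβa, hβb, zsmul_eq_mul, mul_one,
    mul_zero, add_zero, zero_add] at hα hβ ⊢
  rw [hα, hβ, zero_mul, zero_mul, zero_add]

theorem exists_eq_nsmul_add (h : IsStandardGenerators p m n d a b c) (hαa : α a = 1)
    (hαb : α b = 0) (hβa : β a = 0) (hβb : β b = 1) {x : G} (hα : α x = 0) (hβ : β x = 0) :
    ∃ (u v : G) (k : ℤ), x = p • u + p • v + k • c := by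
  obtain ⟨i, j, k, rfl⟩ := h.exists_zsmul x
  simp only [map_add, map_zsmul, h.map_c_eq_zero, hαa, hαb, hβa, hβb, zsmul_eq_mul, mul_one,
    mul_zero, add_zero, zero_add] at hα hβ
  obtain ⟨i, rfl⟩ := (ZMod.intCast_zmod_eq_zero_iff_dvd _ _).1 hα
  obtain ⟨j, rfl⟩ := (ZMod.intCast_zmod_eq_zero_iff_dvd _ _).1 hβ
  exact ⟨i • a, j • b, k, by rw [mul_zsmul, mul_zsmul, natCast_zsmul, natCast_zsmul]⟩

end Reduction

/-- Two elements that generate `G` modulo the Frattini subgroup are part of a triple of standard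
generators as soon as their orders allow it. -/
theorem exists_of_det_ne_zero (h : IsStandardGenerators p m n d a b c) (hp : p.Prime)
    (hp2 : Odd p) (hdn : d ≤ n) (hnm : n ≤ m) {α β : G →+ ZMod p} (hαa : α a = 1)
    (hαb : α b = 0) (hβa : β a = 0) (hβb : β b = 1) {a' b' : G} (hb' : (p ^ n) • b' = 0)
    (hdet : α a' * β b' - β a' * α b' ≠ 0) :
    ∃ c', IsStandardGenerators p m n d a' b' c' := by
  obtain ⟨k, hk⟩ := h.exists_commutator a' b'
  have hcen : ∀ x, AddCommute (k • c) x := fun x => (h.central x).zsmul_left k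
  have := normal_zmultiples_of_central hcen
  obtain ⟨Q, _, q, hq⟩ := h.exists_hom
  have hlift : ∀ (x : G) (i j : ℤ), q x = i • q a' + j • q b' →
      ∃ l : ℤ, x = i • a' + j • b' + l • c := by
    intro x i j hx
    obtain ⟨l, hl⟩ := AddSubgroup.mem_zmultiples_iff.1
      ((hq (-(i • a' + j • b') + x)).1 (by simp [hx]))
    exact ⟨l, by rw [hl, add_neg_cancel_left]⟩
  obtain ⟨x, y, z, ha'⟩ := h.exists_zsmul a'
  obtain ⟨x', y', z', hb''⟩ := h.exists_zsmul b'
  have hqc : q c = 0 := h.map_c_eq_zero q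
  have hqa : q a' = x • q a + y • q b := by rw [ha']; simp [hqc]
  have hqb : q b' = x' • q a + y' • q b := by rw [hb'']; simp [hqc]
  have hdet' : ((x * y' - y * x' : ℤ) : ZMod p) ≠ 0 := by
    rw [ha', hb''] at hdet
    simpa [hαa, hαb, hβa, hβb, h.map_c_eq_zero] using hdet
  have hcop : IsCoprime (x * y' - y * x') ((p ^ m : ℕ) : ℤ) := by
    rw [Nat.cast_pow]
    refine IsCoprime.pow_right (IsCoprime.symm ?_)
    rw [Prime.coprime_iff_not_dvd (Nat.prime_iff_prime_int.1 hp)]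
    rwa [Ne, ZMod.intCast_zmod_eq_zero_iff_dvd] at hdet'
  obtain ⟨e, f, hef⟩ := hcop
  have hexp : ∀ w : G, ((p ^ m : ℕ) : ℤ) • q w = 0 := by
    intro w
    rw [natCast_zsmul, ← map_nsmul, h.nsmul_eq_zero hp2 hdn hnm, map_zero]
  have hunit : ∀ w : G, (e * (x * y' - y * x')) • q w = q w := by
    intro w
    have : (e * (x * y' - y * x')) • q w + (f * ((p ^ m : ℕ) : ℤ)) • q w = q w := by
      rw [← add_zsmul, hef, one_zsmul]
    rwa [mul_zsmul _ f, hexp, zsmul_zero, add_zero] at this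
  -- Cramer's rule modulo ⟨c⟩, where e inverts the determinant modulo the exponent p^m.
  obtain ⟨l, hl⟩ := hlift a (e * y') (-(e * y)) (by
    rw [hqa, hqb]; nth_rewrite 1 [← hunit a]; module)
  obtain ⟨l', hl'⟩ := hlift b (-(e * x')) (e * x) (by
    rw [hqa, hqb]; nth_rewrite 1 [← hunit b]; module)
  -- Modulo the commutator k • c of a' and b', these two commute; a and b are combinations of them
  -- and of the central c, so they commute as well and c dies.
  have hc : c ∈ AddSubgroup.zmultiples (k • c) := by
    let r := QuotientAddGroup.mk' (AddSubgroup.zmultiples (k • c))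
    refine (QuotientAddGroup.eq_zero_iff c).1 (show r c = 0 from ?_)
    have hrk : r (k • c) = 0 := (QuotientAddGroup.eq_zero_iff _).2 (AddSubgroup.mem_zmultiples _)
    have hrab : AddCommute (r a') (r b') := by
      have := congrArg r hk
      rwa [map_add, map_add, map_add, hrk, add_zero] at this
    have hrc : ∀ w, AddCommute (r c) (r w) := fun w => (h.central w).map r
    have hw : ∀ (w : G) (i j l : ℤ), AddCommute (r a') (r w) → AddCommute (r b') (r w) →
        AddCommute (r (i • a' + j • b' + l • c)) (r w) := by
      intro w i j l h1 h2
      simp only [map_add, map_zsmul]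
      exact ((h1.zsmul_left i).add_left (h2.zsmul_left j)).add_left ((hrc w).zsmul_left l)
    have hra : AddCommute (r a') (r a) := by
      rw [hl]; exact (hw a' _ _ _ (AddCommute.refl _) hrab.symm).symm
    have hrb : AddCommute (r b') (r a) := by
      rw [hl]; exact (hw b' _ _ _ hrab (AddCommute.refl _)).symm
    have hrba : AddCommute (r b) (r a) := by
      nth_rewrite 1 [hl']; exact hw a _ _ _ hra hrb
    have := congrArg r h.add_comm_a_b
    rw [map_add, map_add, map_add, hrba.eq] at this
    exact left_eq_add.1 this
  have hgen : AddSubgroup.closure {a', b', k • c} = ⊤ := by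
    rw [eq_top_iff, ← h.closure_eq_top, AddSubgroup.closure_le]
    have ha1 : a' ∈ AddSubgroup.closure {a', b', k • c} :=
      AddSubgroup.subset_closure (by simp)
    have hb1 : b' ∈ AddSubgroup.closure {a', b', k • c} :=
      AddSubgroup.subset_closure (by simp)
    have hc1 : c ∈ AddSubgroup.closure {a', b', k • c} :=
      AddSubgroup.zmultiples_le.2 (AddSubgroup.subset_closure (by simp)) hc
    have hmem : ∀ i j l : ℤ, i • a' + j • b' + l • c ∈ AddSubgroup.closure {a', b', k • c} :=
      fun i j l => add_mem (add_mem (zsmul_mem ha1 i) (zsmul_mem hb1 j)) (zsmul_mem hc1 l)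
    rintro w (rfl | rfl | rfl)
    · rw [hl]; exact hmem _ _ _
    · rw [hl']; exact hmem _ _ _
    · exact hc1
  refine ⟨k • c, isStandardGenerators_of_card hp (h.nsmul_eq_zero hp2 hdn hnm a') hb' ?_ hk hcen
    hgen h.card.ge⟩
  rw [← natCast_zsmul, ← mul_zsmul', mul_comm, mul_zsmul', natCast_zsmul, h.nsmul_c, zsmul_zero]

end IsStandardGenerators

end StandardGenerators

/-! ### A Heisenberg model, bounding the order from below -/

section Model

variable {S T U : Type*} [Ring S] [Ring T] [Ring U]

/-- The Heisenberg group with coordinates in three rings. -/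
structure HeisenbergTriple (f : S →+* U) (g : T →+* U) where
  /-- the first coordinate -/
  x : S
  /-- the second coordinate -/
  y : T
  /-- the central coordinate -/
  z : U

namespace HeisenbergTriple

variable {f : S →+* U} {g : T →+* U}

/-- The minus sign is chosen so that the unit vectors satisfy b⁻¹ a b = a c. -/
instance : Mul (HeisenbergTriple f g) :=
  ⟨fun u v => ⟨u.x + v.x, u.y + v.y, u.z + v.z - g u.y * f v.x⟩⟩
instance : One (HeisenbergTriple f g) := ⟨⟨0, 0, 0⟩⟩
instance : Inv (HeisenbergTriple f g) := ⟨fun u => ⟨-u.x, -u.y, -u.z - g u.y * f u.x⟩⟩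

theorem mul_def (u v : HeisenbergTriple f g) :
    u * v = ⟨u.x + v.x, u.y + v.y, u.z + v.z - g u.y * f v.x⟩ := rfl

theorem one_def : (1 : HeisenbergTriple f g) = ⟨0, 0, 0⟩ := rfl

theorem inv_def (u : HeisenbergTriple f g) : u⁻¹ = ⟨-u.x, -u.y, -u.z - g u.y * f u.x⟩ := rfl

instance : Group (HeisenbergTriple f g) :=
  Group.ofLeftAxioms
    (by
      intro u v w
      simp only [mul_def, map_add, mk.injEq, add_assoc, true_and]
      noncomm_ring)
    (by intro u; simp [mul_def, one_def])
    (by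
      intro u
      simp only [mul_def, one_def, inv_def, map_neg, neg_add_cancel, mk.injEq, true_and]
      noncomm_ring)

theorem mk_x_pow (s : S) (k : ℕ) :
    (⟨s, 0, 0⟩ : HeisenbergTriple f g) ^ k = ⟨k • s, 0, 0⟩ := by
  induction k with
  | zero => simp [one_def]
  | succ k ih => simp [pow_succ, ih, mul_def, add_mul]

theorem mk_y_pow (t : T) (k : ℕ) :
    (⟨0, t, 0⟩ : HeisenbergTriple f g) ^ k = ⟨0, k • t, 0⟩ := by
  induction k with
  | zero => simp [one_def]
  | succ k ih => simp [pow_succ, ih, mul_def, add_mul]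

theorem mk_z_pow (r : U) (k : ℕ) :
    (⟨0, 0, r⟩ : HeisenbergTriple f g) ^ k = ⟨0, 0, k • r⟩ := by
  induction k with
  | zero => simp [one_def]
  | succ k ih => simp [pow_succ, ih, mul_def, add_mul]

end HeisenbergTriple

end Model

/-! ### The presented group: normal forms and reductions mod p -/

namespace GroupG

variable {p m n d : ℕ}

/-- A homomorphism from `G(p^m, p^n, p^d)` given by the images of the generators. -/
theorem exists_hom {H : Type*} [Group H] {a b c : H} (ha : a ^ p ^ m = 1) (hb : b ^ p ^ n = 1)
    (hc : c ^ p ^ d = 1) (hab : b⁻¹ * a * b = a * c) (hca : a⁻¹ * c * a = c)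
    (hcb : b⁻¹ * c * b = c) : ∃ φ : GroupG p m n d →* H,
      φ (PresentedGroup.of 0) = a ∧ φ (PresentedGroup.of 1) = b ∧ φ (PresentedGroup.of 2) = c := by
  have hrel : ∀ r ∈ relators p m n d, FreeGroup.lift ![a, b, c] r = 1 := by
    rintro r (rfl | rfl | rfl | rfl | rfl | rfl) <;>
      simp [genA, genB, genC, ha, hb, hc, mul_inv_eq_one, hca, hcb, -mul_inv_rev]
    exact hab
  exact ⟨PresentedGroup.toGroup hrel, by simp, by simp, by simp⟩

theorem relations :
    let a : GroupG p m n d := PresentedGroup.of 0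
    let b : GroupG p m n d := PresentedGroup.of 1
    let c : GroupG p m n d := PresentedGroup.of 2
    a ^ p ^ m = 1 ∧ b ^ p ^ n = 1 ∧ c ^ p ^ d = 1 ∧ a * b = b * a * c ∧ Commute c a ∧
      Commute c b := by
  have h : ∀ r ∈ relators p m n d, PresentedGroup.mk (relators p m n d) r = 1 :=
    fun r hr => PresentedGroup.one_of_mem hr
  refine ⟨h (genA ^ p ^ m) (by simp [relators]), h (genB ^ p ^ n) (by simp [relators]),
    h (genC ^ p ^ d) (by simp [relators]), ?_, ?_, ?_⟩
  · have := h (genB⁻¹ * genA * genB * (genA * genC)⁻¹) (by simp [relators])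
    rw [map_mul, map_inv, mul_inv_eq_one] at this
    simp only [map_mul, map_inv] at this
    rw [mul_assoc, inv_mul_eq_iff_eq_mul, ← mul_assoc] at this
    exact this
  · have := h (genA⁻¹ * genC * genA * genC⁻¹) (by simp [relators])
    rw [map_mul, map_inv, mul_inv_eq_one] at this
    simp only [map_mul, map_inv] at this
    rw [mul_assoc, inv_mul_eq_iff_eq_mul] at this
    exact this
  · have := h (genB⁻¹ * genC * genB * genC⁻¹) (by simp [relators])
    rw [map_mul, map_inv, mul_inv_eq_one] at this
    simp only [map_mul, map_inv] at this
    rw [mul_assoc, inv_mul_eq_iff_eq_mul] at this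
    exact this

theorem injective_coeffs (hdn : d ≤ n) (hnm : n ≤ m) :
    Function.Injective fun t : Fin (p ^ m) × Fin (p ^ n) × Fin (p ^ d) =>
      (PresentedGroup.of 0 : GroupG p m n d) ^ (t.1 : ℕ) * PresentedGroup.of 1 ^ (t.2.1 : ℕ)
        * PresentedGroup.of 2 ^ (t.2.2 : ℕ) := by
  -- The inequalities d ≤ n ≤ m are what make both reductions to `ZMod (p ^ d)` exist.
  let f := ZMod.castHom (pow_dvd_pow p (hdn.trans hnm)) (ZMod (p ^ d))
  let g := ZMod.castHom (pow_dvd_pow p hdn) (ZMod (p ^ d))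
  obtain ⟨φ, h0, h1, h2⟩ := exists_hom (p := p) (m := m) (n := n) (d := d)
    (H := HeisenbergTriple f g) (a := ⟨1, 0, 0⟩) (b := ⟨0, 1, 0⟩) (c := ⟨0, 0, 1⟩)
    (by simp [HeisenbergTriple.mk_x_pow, HeisenbergTriple.one_def])
    (by simp [HeisenbergTriple.mk_y_pow, HeisenbergTriple.one_def])
    (by simp [HeisenbergTriple.mk_z_pow, HeisenbergTriple.one_def])
    (by simp [HeisenbergTriple.mul_def, HeisenbergTriple.inv_def])
    (by simp [HeisenbergTriple.mul_def, HeisenbergTriple.inv_def])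
    (by simp [HeisenbergTriple.mul_def, HeisenbergTriple.inv_def])
  rintro ⟨i, j, k⟩ ⟨i', j', k'⟩ h
  have h := congrArg φ h
  simp only [map_mul, map_pow, h0, h1, h2, HeisenbergTriple.mk_x_pow, HeisenbergTriple.mk_y_pow,
    HeisenbergTriple.mk_z_pow, HeisenbergTriple.mul_def, HeisenbergTriple.mk.injEq] at h
  simp only [nsmul_eq_mul, mul_one, map_zero, mul_zero, add_zero, zero_add, sub_zero] at h
  obtain ⟨hi, hj, hk⟩ := h
  have hval : ∀ {N : ℕ} (u v : Fin N), ((u : ℕ) : ZMod N) = ((v : ℕ) : ZMod N) → u = v := by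
    intro N u v huv
    have := (ZMod.natCast_eq_natCast_iff' _ _ _).1 huv
    rw [Nat.mod_eq_of_lt u.2, Nat.mod_eq_of_lt v.2] at this
    exact Fin.ext this
  rw [hval _ _ hi, hval _ _ hj, hval _ _ hk]

/-- An additive group isomorphic to `G(p^m, p^n, p^d)` has standard generators, and its
reductions mod `p` of the first two coordinates are homomorphisms. -/
theorem exists_isStandardGenerators {A : Type u} [AddGroup A] (hp : p.Prime) (hd : 1 ≤ d)
    (hdn : d ≤ n) (hnm : n ≤ m) (hG : Nonempty (Multiplicative A ≃* GroupG p m n d)) :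
    ∃ (a b c : A) (α β : A →+ ZMod p), IsStandardGenerators p m n d a b c ∧
      α a = 1 ∧ α b = 0 ∧ β a = 0 ∧ β b = 1 := by
  obtain ⟨e⟩ := hG
  let ψ : GroupG p m n d → A := fun x => (e.symm x).toAdd
  have hψ : ∀ x y, ψ (x * y) = ψ x + ψ y := fun x y => by simp [ψ]
  have hψ1 : ψ 1 = 0 := by simp [ψ]
  have hψp : ∀ x (k : ℕ), ψ (x ^ k) = k • ψ x := fun x k => by simp [ψ]
  have hψb : Function.Bijective ψ := e.symm.bijective
  have key : ∀ s t : ZMod p, ∃ α : A →+ ZMod p,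
      α (ψ (PresentedGroup.of 0)) = s ∧ α (ψ (PresentedGroup.of 1)) = t := by
    intro s t
    have hs : ∀ {k : ℕ} (s : ZMod p), 1 ≤ k → Multiplicative.ofAdd s ^ p ^ k = 1 := by
      intro k s hk
      rw [← ofAdd_nsmul, nsmul_eq_mul, Nat.cast_pow, ZMod.natCast_self,
        zero_pow (by omega), zero_mul, ofAdd_zero]
    obtain ⟨φ, h0, h1, -⟩ := exists_hom (p := p) (m := m) (n := n) (d := d)
      (H := Multiplicative (ZMod p)) (a := Multiplicative.ofAdd s) (b := Multiplicative.ofAdd t)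
      (c := 1) (hs s (by omega)) (hs t (by omega)) (one_pow _)
      (by rw [mul_comm _ (Multiplicative.ofAdd s), mul_assoc, inv_mul_cancel])
      (by simp) (by simp)
    refine ⟨AddMonoidHom.mk' (fun x => (φ (e (Multiplicative.ofAdd x))).toAdd) fun x y => by simp,
      ?_, ?_⟩
    · simp [ψ, h0]
    · simp [ψ, h1]
  obtain ⟨α, hα0, hα1⟩ := key 1 0
  obtain ⟨β, hβ0, hβ1⟩ := key 0 1
  refine ⟨_, _, ψ (PresentedGroup.of 2), α, β, ?_, hα0, hα1, hβ0, hβ1⟩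
  obtain ⟨ha, hb, hc, hab, hca, hcb⟩ := relations (p := p) (m := m) (n := n) (d := d)
  have hgen : AddSubgroup.closure {ψ (PresentedGroup.of 0), ψ (PresentedGroup.of 1),
      ψ (PresentedGroup.of 2)} = ⊤ := by
    rw [eq_top_iff]
    rintro x -
    obtain ⟨y, rfl⟩ := hψb.2 x
    have hy : y ∈ Subgroup.closure (Set.range PresentedGroup.of) := by
      rw [PresentedGroup.closure_range_of]; trivial
    induction hy using Subgroup.closure_induction with
    | mem y hy =>
      obtain ⟨i, rfl⟩ := hy
      apply AddSubgroup.subset_closure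
      fin_cases i <;> simp
    | one => rw [hψ1]; exact zero_mem _
    | mul x y _ _ hx hy => rw [hψ]; exact add_mem hx hy
    | inv x _ hx =>
      have : ψ x⁻¹ = -ψ x := by simp [ψ]
      rw [this]
      exact neg_mem hx
  have hcen := addCommute_of_closure_eq_top hgen (c := ψ (PresentedGroup.of 2)) (by
    rintro x (rfl | rfl | rfl)
    · exact (hψ _ _).symm.trans ((congrArg ψ hca.eq).trans (hψ _ _))
    · exact (hψ _ _).symm.trans ((congrArg ψ hcb.eq).trans (hψ _ _))
    · exact AddCommute.refl _)
  have ha' : (p ^ m) • ψ (PresentedGroup.of 0) = 0 := by rw [← hψp, ha, hψ1]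
  have hb' : (p ^ n) • ψ (PresentedGroup.of 1) = 0 := by rw [← hψp, hb, hψ1]
  have hc' : (p ^ d) • ψ (PresentedGroup.of 2) = 0 := by rw [← hψp, hc, hψ1]
  have hab' : ψ (PresentedGroup.of 0) + ψ (PresentedGroup.of 1) =
      ψ (PresentedGroup.of 1) + ψ (PresentedGroup.of 0) + ψ (PresentedGroup.of 2) := by
    rw [← hψ, hab, hψ, hψ]
  refine isStandardGenerators_of_card hp ha' hb' hc' hab' hcen hgen ?_
  -- Finiteness must come first: `Nat.card` of an infinite type is 0, and the injection from normal
  -- forms would bound nothing.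
  have : Finite A := Finite.of_surjective _ (surjective_coeffs hp ha' hb' hc' hab' hcen hgen)
  have h := Nat.card_le_card_of_injective _
    (hψb.1.comp (injective_coeffs (p := p) (m := m) (n := n) (d := d) hdn hnm))
  simpa [pow_add, mul_assoc] using h

end GroupG

/-! ### Left multiplications in a nearring -/

namespace LeftNearring

variable {R : Type u} [LeftNearring R]

/-- Left multiplication by `x` as an additive endomorphism. -/
def mulLeft (x : R) : R →+ R := AddMonoidHom.mk' (x * ·) (LeftNearring.left_distrib x)

theorem mul_add' (x y z : R) : x * (y + z) = x * y + x * z := LeftNearring.left_distrib x y z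

theorem mul_zero' (x : R) : x * 0 = 0 := map_zero (mulLeft x)

theorem mul_neg' (x y : R) : x * -y = -(x * y) := map_neg (mulLeft x) y

theorem mul_nsmul_comm (x y : R) (k : ℕ) : x * k • y = k • (x * y) := map_nsmul (mulLeft x) k y

theorem mul_zsmul_comm (x y : R) (k : ℤ) : x * k • y = k • (x * y) := map_zsmul (mulLeft x) k y

theorem neg_one_mul_neg_one_mul (x : R) : (-1 : R) * (-1 * x) = x := by
  rw [← mul_assoc, mul_neg', mul_one, neg_neg, one_mul]

/-- The source of rigidity: units have trivial stabilizer under left multiplication. -/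
theorem eq_one_of_mul_eq_self {x y : R} (hy : IsUnit y) (h : x * y = y) : x = 1 :=
  hy.mul_right_cancel (h.trans (one_mul y).symm)

end LeftNearring

/-! ### The index of L, and admissible pairs -/

namespace LocalNearring

open LeftNearring

section

variable {R : Type u} [LocalNearring R]

theorem mem_nonunitsAddSubgroup {x : R} : x ∈ nonunitsAddSubgroup R ↔ ¬ IsUnit x := Iff.rfl

theorem one_notMem : (1 : R) ∉ nonunitsAddSubgroup R := fun h => h isUnit_one

end

section StandardGenerators

variable {R : Type u} [LocalNearring R] {p m n d : ℕ} {a b c : R} {α β : R →+ ZMod p}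

/-- ⟨c⟩ is the commutator subgroup, so every endomorphism preserves it. -/
theorem mul_c_mem (h : IsStandardGenerators p m n d a b c) (x : R) :
    ∃ k : ℤ, x * c = k • c := by
  obtain ⟨Q, _, q, hq⟩ := h.exists_hom
  obtain ⟨k, hk⟩ := AddSubgroup.mem_zmultiples_iff.1
    ((hq (x * c)).1 (h.map_c_eq_zero (q.comp (mulLeft x))))
  exact ⟨k, hk.symm⟩

/-- The Frattini subgroup of `(R, +)` consists of non-invertible elements. -/
theorem ker_le_nonunits (h : IsStandardGenerators p m n d a b c) (hp : p.Prime) (hαa : α a = 1)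
    (hαb : α b = 0) (hβa : β a = 0) (hβb : β b = 1) :
    (α.prod β).ker ≤ nonunitsAddSubgroup R := by
  intro x hx hu
  obtain ⟨hα, hβ⟩ := Prod.mk.inj (show (α x, β x) = (0, 0) from hx)
  have key : ∀ {y : R}, α y = 0 → β y = 0 → ∀ z, α (z * y) = 0 ∧ β (z * y) = 0 :=
    fun h1 h2 z => ⟨h.map_eq_zero hαa hαb hβa hβb h1 h2 (α.comp (mulLeft z)),
      h.map_eq_zero hαa hαb hβa hβb h1 h2 (β.comp (mulLeft z))⟩
  -- A unit in Φ would put 1 in Φ, and then a = a * 1 too, contradicting α a = 1.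
  obtain ⟨y, hy⟩ := hu.exists_left_inv
  obtain ⟨h1, h2⟩ := key hα hβ y
  rw [hy] at h1 h2
  have : Fact p.Prime := ⟨hp⟩
  have h3 := (key h1 h2 a).1
  rw [mul_one, hαa] at h3
  exact one_ne_zero h3

/-- In `R` one can divide by two. -/
theorem half_nsmul (h : IsStandardGenerators p m n d a b c) (hp2 : Odd p) (hdn : d ≤ n)
    (hnm : n ≤ m) : ∃ e : ℕ, ∀ x : R, e • (2 • x) = x := by
  -- The inverse of 2 is (p^m + 1) / 2, since p^m kills `R`.
  obtain ⟨e, he⟩ := hp2.pow (n := m)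
  refine ⟨e + 1, fun x => ?_⟩
  rw [← mul_nsmul, show 2 * (e + 1) = p ^ m + 1 by omega, add_nsmul,
    h.nsmul_eq_zero hp2 hdn hnm, zero_add, one_nsmul]

/-- An element that acts as an inversion modulo `⟨c⟩` fixes `c`. -/
theorem mul_c_eq_of_add_mul_mem (h : IsStandardGenerators p m n d a b c) {s : R}
    (hs : ∀ x, ∃ k : ℤ, x + s * x = k • c) : s * c = c := by
  obtain ⟨k, hk⟩ := hs a
  obtain ⟨l, hl⟩ := hs b
  have hc : ∀ (k : ℤ) (x : R), k • c + x = x + k • c :=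
    fun k x => ((h.central x).zsmul_left k).eq
  have ha : s * a = -a + k • c := by rw [← hk, neg_add_cancel_left]
  have hb : s * b = -b + l • c := by rw [← hl, neg_add_cancel_left]
  have h1 := congrArg (s * ·) h.add_comm_a_b
  simp only [mul_add'] at h1
  -- Both signs cancel in the commutator, and the central corrections k • c, l • c do not affect it.
  have h2 : -a + -b = -b + -a + c := by
    have h3 : a + b = c + (b + a) := by rw [h.add_comm_a_b, (h.central _).eq]
    have h4 := congrArg Neg.neg h3
    rw [neg_add_rev, neg_add_rev, neg_add_rev] at h4
    rw [h4, neg_add_cancel_right]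
  have h5 : s * a + s * b = -a + -b + (k • c + l • c) := by
    rw [ha, hb, add_assoc, ← add_assoc (k • c), hc, add_assoc, add_assoc]
  have h6 : s * b + s * a = -b + -a + (k • c + l • c) := by
    rw [ha, hb, add_assoc, ← add_assoc (l • c), hc, add_assoc, add_assoc, hc l (k • c)]
  rw [h5, h6, h2, add_assoc (-b + -a), add_assoc (-b + -a), add_left_cancel_iff,
    (h.central _).eq, add_left_cancel_iff] at h1
  exact h1.symm

/-- If every non-invertible element lies in the Frattini subgroup, then `-1` acts as an inversion
modulo `⟨c⟩`. -/
theorem add_neg_one_mul_mem (h : IsStandardGenerators p m n d a b c) (hp2 : Odd p)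
    (hdn : d ≤ n) (hnm : n ≤ m) (hαa : α a = 1) (hαb : α b = 0) (hβa : β a = 0) (hβb : β b = 1)
    (hu : ∀ x : R, ¬ (α x = 0 ∧ β x = 0) → IsUnit x) (x : R) :
    ∃ k : ℤ, x + -1 * x = k • c := by
  obtain ⟨e, he⟩ := half_nsmul h hp2 hdn hnm
  have hneg : (-1 : R) ≠ 1 := by
    intro h1
    have h0 : (1 : R) = 0 := by
      have h2 : 2 • (1 : R) = 0 := by
        rw [two_nsmul]; nth_rewrite 1 [← h1]; exact neg_add_cancel 1
      rw [← he 1, h2, nsmul_zero]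
    have ha : a = 0 := by rw [← mul_one a, h0, mul_zero']
    have hb : b = 0 := by rw [← mul_one b, h0, mul_zero']
    have hua : IsUnit (0 : R) := by rw [← h0]; exact isUnit_one
    exact mem_nonunitsAddSubgroup.1 (zero_mem _) hua
  have hmod : ∀ x : R, α (x + -1 * x) = 0 ∧ β (x + -1 * x) = 0 := by
    intro x
    by_contra hx
    set y := x + -1 * x with hy
    have hsy : -1 * y = -1 * x + x := by rw [hy, mul_add', neg_one_mul_neg_one_mul]
    -- φ measures how far -1 is from fixing y. It is negated by -1 and vanishes under maps to `ZMod
    -- p`, so adding half of it gives y + e • φ, fixed by -1 and still outside Φ, hence a unit.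
    set φ := -y + -1 * y with hφ
    have hφ' : -1 * φ = -φ := by
      rw [hφ, mul_add', neg_one_mul_neg_one_mul, mul_neg', neg_add_rev, neg_neg]
    have hf : ∀ f : R →+ ZMod p, f φ = 0 := by
      intro f
      rw [hφ, hsy, hy]
      simp only [map_add, map_neg]
      abel
    have hw : ¬ (α (y + e • φ) = 0 ∧ β (y + e • φ) = 0) := by
      simpa only [map_add, map_nsmul, hf, nsmul_zero, add_zero] using hx
    refine hneg (eq_one_of_mul_eq_self (hu _ hw) ?_)
    have h1 : -1 * y = y + φ := by rw [hφ, add_neg_cancel_left]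
    have h2 : φ = e • φ + e • φ := by
      rw [← two_nsmul, ← mul_nsmul', mul_comm, mul_nsmul', he]
    rw [mul_add', mul_nsmul_comm, hφ', h1, add_assoc]
    nth_rewrite 1 [h2]
    rw [neg_nsmul, add_neg_cancel_right]
  obtain ⟨Q, _, q, hq⟩ := h.exists_hom
  have hker : ∀ {y : R}, q y = 0 → q (-1 * y) = 0 := by
    intro y hy
    obtain ⟨k, rfl⟩ := AddSubgroup.mem_zmultiples_iff.1 ((hq y).1 hy)
    rw [mul_zsmul_comm, map_zsmul,
      show q (-1 * c) = 0 from h.map_c_eq_zero (q.comp (mulLeft (-1))), zsmul_zero]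
  -- If y = p^j z modulo ⟨c⟩, averaging with -1 gives 2y = p^j (z + -1 * z), and z + -1 * z lies in
  -- Φ, which supplies another factor p. At j = m the exponent kills everything.
  have hdiv : ∀ j : ℕ, ∃ z, q (x + -1 * x) = p ^ j • q z := by
    intro j
    set y := x + -1 * x with hy
    have hsy : q (-1 * y) = q y := by
      rw [hy, mul_add', neg_one_mul_neg_one_mul, map_add, map_add, add_comm]
    induction j with
    | zero => exact ⟨y, by rw [pow_zero, one_nsmul]⟩
    | succ j ih =>
      obtain ⟨z, hz⟩ := ih
      have h1 := hker (y := y + -(p ^ j • z)) (by rw [map_add, map_neg, map_nsmul, hz]; abel)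
      rw [mul_add', mul_neg', mul_nsmul_comm, map_add, map_neg, map_nsmul, hsy,
        add_neg_eq_zero] at h1
      obtain ⟨u, v, k, hw⟩ :=
        h.exists_eq_nsmul_add hαa hαb hβa hβb (hmod z).1 (hmod z).2
      have h2 : 2 • q y = p ^ (j + 1) • q (u + v) := by
        rw [two_nsmul]
        nth_rewrite 1 [hz]
        rw [h1, ← nsmul_add, ← map_add, hw, map_add, map_zsmul, h.map_c_eq_zero q, zsmul_zero,
          add_zero, ← map_nsmul, pow_succ, mul_nsmul', ← map_nsmul, ← map_nsmul]
        simp only [map_nsmul, map_add, nsmul_add]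
      refine ⟨e • (u + v), ?_⟩
      rw [← he y, map_nsmul, map_nsmul, h2, map_nsmul, ← mul_nsmul', ← mul_nsmul', mul_comm]
  obtain ⟨z, hz⟩ := hdiv m
  rw [← map_nsmul, h.nsmul_eq_zero hp2 hdn hnm, map_zero] at hz
  obtain ⟨k, hk⟩ := AddSubgroup.mem_zmultiples_iff.1 ((hq _).1 hz)
  exact ⟨k, hk.symm⟩

/-- The Frattini subgroup of `(R, +)` does not contain all non-invertible elements. -/
theorem exists_nonunit_notMem_ker (h : IsStandardGenerators p m n d a b c) (hp : p.Prime)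
    (hp2 : Odd p) (hd : 1 ≤ d) (hdn : d ≤ n) (hnm : n ≤ m) (hαa : α a = 1) (hαb : α b = 0)
    (hβa : β a = 0) (hβb : β b = 1) : ∃ x : R, ¬ (α x = 0 ∧ β x = 0) ∧ ¬ IsUnit x := by
  by_contra hne
  have hu : ∀ x : R, ¬ (α x = 0 ∧ β x = 0) → IsUnit x :=
    fun x hx => by_contra fun hxu => hne ⟨x, hx, hxu⟩
  have hle := ker_le_nonunits h hp hαa hαb hβa hβb
  have hs := add_neg_one_mul_mem h hp2 hdn hnm hαa hαb hβa hβb hu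
  have hsc := mul_c_eq_of_add_mul_mem h hs
  have hcen : ∀ (k : ℤ) (x : R), k • c + x = x + k • c :=
    fun k x => ((h.central x).zsmul_left k).eq
  obtain ⟨v, hv⟩ : IsUnit (1 + c) := by
    refine hu _ ?_
    rw [map_add, map_add, h.map_c_eq_zero, h.map_c_eq_zero, add_zero, add_zero]
    rintro ⟨h1, h2⟩
    exact one_notMem (hle (show α.prod β 1 = 0 from Prod.ext h1 h2))
  set t : R := v * -1 * (↑v⁻¹ : R) with ht
  have htm : ∀ x, ∃ k : ℤ, x + t * x = k • c := by
    intro x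
    obtain ⟨k, hk⟩ := hs (↑v⁻¹ * x)
    obtain ⟨l, hl⟩ := mul_c_mem h (v : R)
    refine ⟨k * l, ?_⟩
    have := congrArg ((v : R) * ·) hk
    simp only [mul_add', mul_zsmul_comm, hl, ← mul_assoc, Units.mul_inv, one_mul] at this
    rw [mul_zsmul, ← this, ht]
  have hact : ∀ x, ∃ k : ℤ, t * -1 * x = x + k • c := by
    intro x
    obtain ⟨k, hk⟩ := hs x
    obtain ⟨l, hl⟩ := htm x
    have h1 : -1 * x = -x + k • c := by rw [← hk, neg_add_cancel_left]
    have h2 : t * x = -x + l • c := by rw [← hl, neg_add_cancel_left]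
    refine ⟨k - l, ?_⟩
    rw [mul_assoc, h1, mul_add', mul_neg', mul_zsmul_comm,
      mul_c_eq_of_add_mul_mem h htm, h2, neg_add_rev, neg_neg, ← neg_zsmul, hcen, add_assoc,
      ← add_zsmul]
    congr 2
    ring
  obtain ⟨k, hk⟩ := hact a
  obtain ⟨l, hl⟩ := hact b
  -- The shifts k and l cancel on i • a + j • b, and coprimality keeps that element outside Φ.
  obtain ⟨i, j, hij, hcop⟩ : ∃ i j : ℤ, i * k + j * l = 0 ∧ IsCoprime i j := by
    rcases eq_or_ne (Int.gcd k l) 0 with h0 | h0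
    · obtain ⟨rfl, rfl⟩ := Int.gcd_eq_zero_iff.1 h0
      exact ⟨1, 0, by simp, isCoprime_one_left⟩
    · obtain ⟨k', l', hc, hk', hl'⟩ := Int.exists_gcd_one (Nat.pos_of_ne_zero h0)
      refine ⟨l', -k', ?_, (Int.isCoprime_iff_gcd_eq_one.2 hc).symm.neg_right⟩
      generalize ((k.gcd l : ℕ) : ℤ) = g at hk' hl'
      rw [hk', hl']
      ring
  have hg : t * -1 * (i • a + j • b) = i • a + j • b := by
    have hz : ∀ (i : ℤ) (x y : R), AddCommute x y → i • (x + y) = i • x + i • y :=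
      fun i x y hxy => hxy.zsmul_add i
    rw [mul_add', mul_zsmul_comm, mul_zsmul_comm, hk, hl,
      hz _ _ _ ((h.central a).zsmul_left k).symm, hz _ _ _ ((h.central b).zsmul_left l).symm,
      ← mul_zsmul, ← mul_zsmul, add_assoc, ← add_assoc ((i * k) • c), hcen, add_assoc,
      ← add_zsmul, hij, zero_zsmul, add_zero]
  have hone : t * -1 = 1 := by
    refine eq_one_of_mul_eq_self (hu _ ?_) hg
    rintro ⟨h1, h2⟩
    have : Fact p.Prime := ⟨hp⟩
    simp only [map_add, map_zsmul, hαa, hαb, hβa, hβb, zsmul_eq_mul, mul_one, mul_zero, add_zero,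
      zero_add] at h1 h2
    obtain ⟨r, s, hrs⟩ := hcop
    have := congrArg (Int.cast : ℤ → ZMod p) hrs
    rw [Int.cast_add, Int.cast_mul, Int.cast_mul, h1, h2] at this
    simp at this
  have hcomm : (v : R) * -1 = -1 * v := by
    have h1 : t = -1 := by
      have h2 : t * -1 * -1 = t := by rw [mul_assoc, mul_neg', mul_one, neg_neg, mul_one]
      rw [← h2, hone, one_mul]
    calc (v : R) * -1 = v * -1 * (↑v⁻¹ * v) := by rw [Units.inv_mul, mul_one]
      _ = t * v := by rw [ht]; simp only [mul_assoc]
      _ = _ := by rw [h1]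
  -- With v = 1 + c, the left side is -(1 + c) and the right side is -1 + c, so 2c = 0.
  rw [hv, mul_neg', mul_one, mul_add', hsc, mul_one, neg_add_rev,
    ← (h.central (-1)).eq, add_right_cancel_iff, neg_eq_iff_add_eq_zero, ← two_nsmul] at hcomm
  obtain ⟨e, he⟩ := half_nsmul h hp2 hdn hnm
  refine h.c_ne_zero (Nat.pow_pos hp.pos) (Nat.pow_pos hp.pos)
    (Nat.one_lt_pow (by omega) hp.one_lt) ?_
  rw [← he c, hcomm, nsmul_zero]

theorem index_nonunits (h : IsStandardGenerators p m n d a b c) (hp : p.Prime)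
    (hp2 : Odd p) (hd : 1 ≤ d) (hdn : d ≤ n) (hnm : n ≤ m) (hαa : α a = 1) (hαb : α b = 0)
    (hβa : β a = 0) (hβb : β b = 1) : (nonunitsAddSubgroup R).index = p := by
  have hle := ker_le_nonunits h hp hαa hαb hβa hβb
  have hsurj : Function.Surjective (α.prod β) := by
    rintro ⟨s, t⟩
    obtain ⟨i, rfl⟩ := ZMod.intCast_surjective s
    obtain ⟨j, rfl⟩ := ZMod.intCast_surjective t
    exact ⟨i • a + j • b, by simp [hαa, hαb, hβa, hβb]⟩
  have hindex : (α.prod β).ker.index = p ^ 2 := by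
    rw [AddSubgroup.index_ker, AddMonoidHom.range_eq_top.2 hsurj, AddSubgroup.card_top,
      Nat.card_prod, Nat.card_zmod, sq]
  have hdvd := AddSubgroup.index_dvd_of_le hle
  rw [hindex, Nat.dvd_prime_pow hp] at hdvd
  obtain ⟨r, hr, hr'⟩ := hdvd
  interval_cases r
  · rw [pow_zero, AddSubgroup.index_eq_one] at hr'
    exact absurd (hr' ▸ AddSubgroup.mem_top 1) one_notMem
  · rw [hr', pow_one]
  · exfalso
    have h1 := AddSubgroup.relIndex_mul_index hle
    rw [hindex, hr'] at h1
    have h2 := AddSubgroup.relIndex_eq_one.1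
      (Nat.eq_of_mul_eq_mul_right (Nat.pow_pos hp.pos) (h1.trans (one_mul _).symm))
    obtain ⟨x, hx, hxu⟩ := exists_nonunit_notMem_ker h hp hp2 hd hdn hnm hαa hαb hβa hβb
    exact hx (Prod.mk.inj (show (α x, β x) = (0, 0) from h2 hxu))

theorem card_units (h : IsStandardGenerators p m n d a b c) (hp : p.Prime) (hd : 1 ≤ d)
    (hindex : (nonunitsAddSubgroup R).index = p) :
    Nat.card Rˣ = p ^ (m + n + d - 1) * (p - 1) := by
  have hcard := h.card
  have : Finite R := Nat.finite_of_card_ne_zero (by rw [hcard]; exact (Nat.pow_pos hp.pos).ne')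
  have hunits : Nat.card Rˣ = Nat.card {x : R // IsUnit x} :=
    Nat.card_congr (Equiv.ofBijective (fun v : Rˣ => (⟨v, v.isUnit⟩ : {x : R // IsUnit x}))
      ⟨fun v w hvw => Units.ext (congrArg Subtype.val hvw),
        fun ⟨_, v, hv⟩ => ⟨v, Subtype.ext hv⟩⟩)
  have hL : Nat.card (nonunitsAddSubgroup R) = p ^ (m + n + d - 1) := by
    have h1 := AddSubgroup.card_mul_index (nonunitsAddSubgroup R)
    rw [hindex, hcard] at h1
    have h2 : p ^ (m + n + d) = p ^ (m + n + d - 1) * p := by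
      rw [← pow_succ]; congr 1; omega
    exact Nat.eq_of_mul_eq_mul_right hp.pos (h1.trans h2)
  have hsum : Nat.card {x : R // IsUnit x} + Nat.card (nonunitsAddSubgroup R) = Nat.card R := by
    classical
    rw [← Nat.card_congr (Equiv.sumCompl fun x : R => IsUnit x), Nat.card_sum]
    rfl
  rw [hunits]
  rw [hL, hcard] at hsum
  have h2 : p ^ (m + n + d) = p ^ (m + n + d - 1) * (p - 1) + p ^ (m + n + d - 1) := by
    rw [← Nat.mul_succ, Nat.succ_eq_add_one, Nat.sub_add_cancel hp.one_le, ← pow_succ]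
    congr 1; omega
  omega

/-- The additive order of an invertible element is the exponent of `(R, +)`. -/
theorem not_isUnit_of_nsmul_eq_zero (h : IsStandardGenerators p m n d a b c) (hp : p.Prime)
    (hnm : n < m) {x : R} (hx : (p ^ n) • x = 0) : ¬ IsUnit x := by
  intro hu
  obtain ⟨y, hy⟩ := hu.exists_left_inv
  have h1 : (p ^ n) • (1 : R) = 0 := by rw [← hy, ← mul_nsmul_comm, hx, mul_zero']
  refine h.nsmul_a_ne_zero (Nat.pow_pos hp.pos) (Nat.pow_lt_pow_right hp.one_lt hnm)
    (Nat.pow_pos hp.pos) (Nat.pow_pos hp.pos) ?_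
  rw [← mul_one a, ← mul_nsmul_comm, h1, mul_zero']

theorem exists_isStandardGenerators_one (h : IsStandardGenerators p m n d a b c) (hp : p.Prime)
    (hp2 : Odd p) (hd : 1 ≤ d) (hdn : d ≤ n) (hnm : n ≤ m) (hαa : α a = 1) (hαb : α b = 0)
    (hβa : β a = 0) (hβb : β b = 1) :
    ∃ b' c' : R, IsStandardGenerators p m n d 1 b' c' ∧ ¬ IsUnit b' := by
  have : Fact p.Prime := ⟨hp⟩
  have hle := ker_le_nonunits h hp hαa hαb hβa hβb
  obtain ⟨b', hb', hmem, hu⟩ :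
      ∃ b' : R, (p ^ n) • b' = 0 ∧ ¬ (α b' = 0 ∧ β b' = 0) ∧ ¬ IsUnit b' := by
    -- For n < m the order of b already makes it a non-unit; for n = m the order condition is
    -- automatic, and any non-unit outside Φ serves.
    rcases hnm.lt_or_eq with hlt | rfl
    · exact ⟨b, h.nsmul_b, fun h0 => one_ne_zero (hβb.symm.trans h0.2),
        not_isUnit_of_nsmul_eq_zero h hp hlt h.nsmul_b⟩
    · obtain ⟨x, hx⟩ := exists_nonunit_notMem_ker h hp hp2 hd hdn le_rfl hαa hαb hβa hβb
      exact ⟨x, h.nsmul_eq_zero hp2 hdn le_rfl x, hx⟩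
  obtain ⟨c', hc'⟩ := h.exists_of_det_ne_zero hp hp2 hdn hnm hαa hαb hβa hβb (a' := 1) hb' (by
    intro hdet
    -- A zero determinant would make 1 a multiple of b' modulo Φ, hence an element of L.
    obtain ⟨s, hs1, hs2⟩ : ∃ s : ZMod p, α 1 = s * α b' ∧ β 1 = s * β b' := by
      by_cases h0 : α b' = 0
      · have h1 : β b' ≠ 0 := fun h1 => hmem ⟨h0, h1⟩
        refine ⟨β 1 / β b', ?_, by field_simp⟩
        rw [h0, mul_zero, sub_zero] at hdet
        rw [h0, mul_zero]
        exact (mul_eq_zero.1 hdet).resolve_right h1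
      · refine ⟨α 1 / α b', by field_simp, ?_⟩
        field_simp
        linear_combination -hdet
    obtain ⟨k, rfl⟩ := ZMod.intCast_surjective s
    have h1 : (1 : R) - k • b' ∈ nonunitsAddSubgroup R := hle (by
      rw [AddMonoidHom.mem_ker]
      simp [hs1, hs2])
    have hb : b' ∈ nonunitsAddSubgroup R := hu
    have := add_mem h1 (zsmul_mem hb k)
    rw [sub_add_cancel] at this
    exact one_notMem this)
  exact ⟨b', c', hc', hu⟩

/-- Invertibility in terms of the coordinates with respect to `1`, `b`, `c`. -/
theorem isUnit_iff (hp : p.Prime) {x y : R} (hone : p • (1 : R) ∈ nonunitsAddSubgroup R)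
    (hx : x ∈ nonunitsAddSubgroup R) (hy : y ∈ nonunitsAddSubgroup R) (x₁ x₂ x₃ : ℤ) :
    IsUnit (x₁ • (1 : R) + x₂ • x + x₃ • y) ↔ ¬ x₁ ≡ 0 [ZMOD (p : ℤ)] := by
  rw [← not_iff_not, not_not, ← mem_nonunitsAddSubgroup,
    AddSubgroup.add_mem_cancel_right _ (zsmul_mem hy x₃),
    AddSubgroup.add_mem_cancel_right _ (zsmul_mem hx x₂), Int.modEq_zero_iff_dvd]
  constructor
  · intro h
    by_contra hdvd
    -- If p does not divide x₁, Bézout combines p • 1 and x₁ • 1 in L into 1.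
    obtain ⟨r, s, hrs⟩ := ((Nat.prime_iff_prime_int.1 hp).coprime_iff_not_dvd.2 hdvd)
    have h1 := add_mem (zsmul_mem hone r) (zsmul_mem h s)
    rw [← natCast_zsmul, ← mul_zsmul', ← mul_zsmul', ← add_zsmul, mul_comm (p : ℤ) r,
      mul_comm x₁ s, hrs, one_zsmul] at h1
    exact one_notMem h1
  · rintro ⟨k, rfl⟩
    rw [mul_comm, mul_zsmul, natCast_zsmul]
    exact zsmul_mem hone k

end StandardGenerators

end LocalNearring

/-! ### The main theorem -/

open LocalNearring

theorem theorem1 {R : Type*} [LocalNearring R] (p m n d : ℕ) (hp : p.Prime) (hp2 : p ≠ 2)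
    (hd : 1 ≤ d) (hdn : d ≤ n) (hnm : n ≤ m)
    (hG : Nonempty (Multiplicative R ≃* GroupG p m n d)) :
    (nonunitsAddSubgroup R).index = p ∧
    Nat.card Rˣ = p ^ (m + n + d - 1) * (p - 1) ∧
    (∃ b c : R, IsStandardGenerators p m n d 1 b c ∧ ¬ IsUnit b) ∧
    (n < m → ∀ b c : R, IsStandardGenerators p m n d 1 b c → ¬ IsUnit b) ∧
    (∀ b c : R, IsStandardGenerators p m n d 1 b c → ¬ IsUnit b →
      (nonunitsAddSubgroup R : Set R) =
        (AddSubgroup.zmultiples (p • (1 : R)) : Set R) + (AddSubgroup.zmultiples b : Set R)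
          + (AddSubgroup.zmultiples c : Set R) ∧
      ∀ x₁ x₂ x₃ : ℤ,
        IsUnit (x₁ • (1 : R) + x₂ • b + x₃ • c) ↔ ¬ x₁ ≡ 0 [ZMOD (p : ℤ)]) := by
  have hodd := hp.odd_of_ne_two hp2
  obtain ⟨A, B, C, α, β, h, hαA, hαB, hβA, hβB⟩ :=
    GroupG.exists_isStandardGenerators hp hd hdn hnm hG
  have hle := ker_le_nonunits h hp hαA hαB hβA hβB
  have hindex := index_nonunits h hp hodd hd hdn hnm hαA hαB hβA hβB
  refine ⟨hindex, card_units h hp hd hindex,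
    exists_isStandardGenerators_one h hp hodd hd hdn hnm hαA hαB hβA hβB,
    fun hlt b c hbc => not_isUnit_of_nsmul_eq_zero h hp hlt hbc.nsmul_b, fun b c hbc hb => ?_⟩
  have hb : b ∈ nonunitsAddSubgroup R := hb
  have hc : c ∈ nonunitsAddSubgroup R :=
    hle (Prod.ext (hbc.map_c_eq_zero α) (hbc.map_c_eq_zero β))
  have hone : p • (1 : R) ∈ nonunitsAddSubgroup R :=
    hle (Prod.ext (by simp) (by simp))
  have hunit := isUnit_iff hp hone hb hc
  refine ⟨?_, hunit⟩
  ext x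
  constructor
  · intro hx
    obtain ⟨i, j, k, rfl⟩ := hbc.exists_zsmul x
    have hi : i ≡ 0 [ZMOD (p : ℤ)] := by
      by_contra hi
      exact hx ((hunit i j k).2 hi)
    obtain ⟨i, rfl⟩ := Int.modEq_zero_iff_dvd.1 hi
    refine Set.add_mem_add (Set.add_mem_add ?_ (AddSubgroup.zsmul_mem_zmultiples b j))
      (AddSubgroup.zsmul_mem_zmultiples c k)
    rw [mul_comm, mul_zsmul, natCast_zsmul]
    exact AddSubgroup.zsmul_mem_zmultiples _ i
  · rintro ⟨_, ⟨u, hu, v, hv, rfl⟩, w, hw, rfl⟩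
    exact add_mem (add_mem (AddSubgroup.zmultiples_le.2 hone hu)
      (AddSubgroup.zmultiples_le.2 hb hv)) (AddSubgroup.zmultiples_le.2 hc hw)
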